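/- A \emph{tree order} is a partially ordered set $(E,\le)$ such that for every $e\in E$ the set $\{x\in E\mid x\le e\}$ is finite and totally ordered by $\le$. Its \emph{immediate predecessor function} $i_E:E\to E\sqcup\{\ast\}$ sends $e$ to $\max\{x\in E\mid x<e\}$ if this set is non-empty, and to $\ast$ otherwise. A monotone map $f:E\to F$ between tree orders is \emph{strict} if $i_F(f(e))=f_\ast(i_E(e))$ for all $e\in E$, where $f_\ast:E\sqcup\{\ast\}\to F\sqcup\{\ast\}$ extends $f$ by $f_\ast(\ast)=\ast$. Let $\mathbf{Tree}$ be the category of tree orders and strict monotone maps, $|-|:\mathbf{Tree}\to\mathbf{Set}$ the forgetful functor, and $(-)^\star:\mathbf{Set}\to\mathbf{Set}$ the functor sending a set $V$ to the set $V^\star$ of finite words in $V$. Let $\mathbf{HHGraph}$ be the category of (possibly infinite) \emph{hierarchical hypergraphs}, i.e. the comma category $|-|\downarrow(-)^\star$: an object is a tree order $E$ (of hyperedges), a set $V$ (of nodes) and a function $E\to V^\star$; a morphism is a pair of a strict monotone map on hyperedges and a function on nodes making the evident square commute. Let $\Delta_{\mathbf{HHGraph}}:\mathbf{Set}\to\mathbf{HHGraph}$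 be the left adjoint of the functor sending a hierarchical hypergraph to its set of nodes; it sends a set $X$ to the hierarchical hypergraph with set of nodes $X$ and no hyperedges. The category of \emph{hierarchical hypergraphs with interface} is the comma category $$\mathbf{HHIGraph}:=\Delta_{\mathbf{HHGraph}}\downarrow \mathrm{Id}_{\mathbf{HHGraph}}.$$ A category is \emph{adhesive} if it has pullbacks along monomorphisms, it has pushouts along monomorphisms (that is, of spans one of whose legs is a monomorphism), and every such pushout square is a Van Kampen square: in every commutative cube having it as bottom face and whose back faces are pullbacks, the top face is a pushout if and only if the front faces are pullbacks. \textbf{Theorem.} The category $\mathbf{HHIGraph}$ is adhesive. -/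

import Mathlib

open CategoryTheory

universe u

/-- A partial order is a tree order if, for every element `e`, the set of predecessors
`{x | x ≤ e}` is a finite chain. -/
structure IsTreeOrder (E : Type u) [PartialOrder E] : Prop where
  finite_pred : ∀ e : E, (Set.Iic e).Finite
  chain_pred : ∀ e : E, IsChain (· ≤ ·) (Set.Iic e)

theorem IsTreeOrder.exists_isGreatest {E : Type u} [PartialOrder E] (hE : IsTreeOrder E) {e : E}
    (h : (Set.Iio e).Nonempty) : ∃ p, IsGreatest (Set.Iio e) p := by
  obtain ⟨m, hm, hmax⟩ := ((hE.finite_pred e).subset Set.Iio_subset_Iic_self).exists_maximal h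
  refine ⟨m, hm, fun x hx => ?_⟩
  rcases (hE.chain_pred e).total (le_of_lt hx) (le_of_lt hm) with hle | hle
  · exact hle
  · exact hmax hx hle

/-- The objects of the category of tree orders. -/
structure TreeOrd : Type (u + 1) where
  carrier : Type u
  [order : PartialOrder carrier]
  isTree : IsTreeOrder carrier

namespace TreeOrd

instance : CoeSort TreeOrd.{u} (Type u) := ⟨TreeOrd.carrier⟩

instance (E : TreeOrd.{u}) : PartialOrder E := E.order

open Classical in
/-- The immediate predecessor function `i_E : E → E ⊔ {∗}`: the greatest element strictly below
`e` if there is some element strictly below `e`, and `∗` (here `none`) otherwise. -/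
noncomputable def immPred (E : TreeOrd.{u}) (e : E) : Option E :=
  if h : (Set.Iio e).Nonempty then some (E.isTree.exists_isGreatest h).choose else none

theorem immPred_eq_some_iff (E : TreeOrd.{u}) (e p : E) :
    E.immPred e = some p ↔ IsGreatest (Set.Iio e) p := by
  unfold immPred
  split_ifs with h
  · have hc := (E.isTree.exists_isGreatest h).choose_spec
    rw [Option.some_inj]
    exact ⟨fun hp => hp ▸ hc, fun hp => hc.unique hp⟩
  · exact ⟨fun hp => by simp at hp, fun hp => absurd ⟨p, hp.1⟩ h⟩

theorem immPred_eq_none_iff (E : TreeOrd.{u}) (e : E) :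
    E.immPred e = none ↔ Set.Iic e = {e} := by
  unfold immPred
  split_ifs with h
  · refine ⟨fun hp => by simp at hp, fun hp => ?_⟩
    obtain ⟨x, hx⟩ := h
    have hx' : x ∈ ({e} : Set E) := hp ▸ (le_of_lt hx : x ≤ e)
    exact absurd hx' (ne_of_lt hx)
  · refine ⟨fun _ => ?_, fun _ => rfl⟩
    ext x
    refine ⟨fun hx => ?_, fun hx => le_of_eq hx⟩
    by_contra hne
    exact h ⟨x, lt_of_le_of_ne hx hne⟩

/-- Morphisms of tree orders: the strict monotone maps, that is, the monotone maps commuting with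
the immediate predecessor functions. -/
@[ext]
structure Hom (E F : TreeOrd.{u}) : Type u where
  toFun : E → F
  monotone' : Monotone toFun
  strict' : ∀ e : E, F.immPred (toFun e) = (E.immPred e).map toFun

/-- The category of tree orders and strict monotone maps. -/
instance : Category.{u} TreeOrd.{u} where
  Hom E F := Hom E F
  id E := ⟨fun e => e, fun _ _ h => h, fun e => by simp⟩
  comp f g := ⟨fun e => g.toFun (f.toFun e), fun _ _ h => g.monotone' (f.monotone' h),
    fun e => by rw [g.strict', f.strict', Option.map_map]; rfl⟩

/-- The forgetful functor `|-|` sending a tree order to its underlying set. -/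
def forget : TreeOrd.{u} ⥤ Type u where
  obj E := E
  map f := ↾(Hom.toFun f)

/-- The empty tree order. -/
def empty : TreeOrd.{u} where
  carrier := PEmpty
  isTree := ⟨fun e => e.elim, fun e => e.elim⟩

/-- The unique morphism out of the empty tree order. -/
def fromEmpty (E : TreeOrd.{u}) : empty ⟶ E where
  toFun e := PEmpty.elim e
  monotone' e := PEmpty.elim e
  strict' e := PEmpty.elim e

end TreeOrd

/-- The Kleene star `(-)^⋆`, sending a set to the set of finite words in it. -/
def kleeneStar : Type u ⥤ Type u where
  obj V := List V
  map f := ↾(List.map f)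

/-- The category of hierarchical hypergraphs: an object consists of a tree order `left` of
hyperedges, a set `right` of nodes and a function `hom` sending a hyperedge to a finite word of
nodes; a morphism is a pair of a strict monotone map and a function making the evident square
commute. -/
abbrev HHGraph : Type (u + 1) := Comma TreeOrd.forget.{u} kleeneStar.{u}

namespace HHGraph

/-- The functor sending a hierarchical hypergraph to its set of nodes. -/
abbrev nodes : HHGraph.{u} ⥤ Type u := Comma.snd TreeOrd.forget kleeneStar

/-- The functor `Δ` sending a set to the hierarchical hypergraph with that set of nodes and
without hyperedges. -/
def discrete : Type u ⥤ HHGraph.{u} where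
  obj X :=
    { left := TreeOrd.empty
      right := X
      hom := ↾(fun e : PEmpty => e.elim) }
  map k :=
    { left := 𝟙 TreeOrd.empty
      right := k
      w := by ext e; exact PEmpty.elim e }

/-- The functor `Δ` is left adjoint to the functor sending a hierarchical hypergraph to its set of
nodes. -/
def discreteAdjunction : discrete.{u} ⊣ nodes.{u} :=
  Adjunction.mkOfHomEquiv
    { homEquiv := fun X G =>
        { toFun := fun f => f.right
          invFun := fun k =>
            { left := TreeOrd.fromEmpty G.left
              right := k
              w := by ext e; exact PEmpty.elim e }
          left_inv := fun f => by
            apply Comma.hom_ext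
            · apply TreeOrd.Hom.ext
              funext e
              exact PEmpty.elim e
            · rfl
          right_inv := fun k => rfl }
      homEquiv_naturality_left_symm := fun f g => by
        apply Comma.hom_ext
        · apply TreeOrd.Hom.ext
          funext e
          exact PEmpty.elim e
        · rfl
      homEquiv_naturality_right := fun f g => rfl }

end HHGraph

/-- The category of hierarchical hypergraphs with interface: the comma category `Δ ↓ Id`, whose
objects consist of a set `left` (the interface), a hierarchical hypergraph `right` and a morphism
`hom : Δ(left) ⟶ right`. -/
abbrev HHIGraph : Type (u + 1) := Comma HHGraph.discrete.{u} (𝟭 HHGraph.{u})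

/-! In a comma category `L ↓ R`, pushouts are computed componentwise if `L` preserves them, and
pullbacks if `R` does, so the Van Kampen condition splits into its two components
(`Comma.adhesive`). This is applied twice: to `forget` and `kleeneStar`, then to the left adjoint
`discrete` and the identity.

The main input is adhesivity of `TreeOrd`. A tree order amounts to a partial function `E → Option E`
that cannot be iterated forever, and strict maps are the maps commuting with these functions.
Pullbacks and pushouts are therefore those of sets with an induced predecessor function, and
adhesivity transfers from `Type u` along `forget`. -/

/-! ### Adhesive comma categories -/

namespace CategoryTheory.Comma

open Limits

universe v₁ v₂ v₃ u₁ u₂ u₃ w w'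

variable {A : Type u₁} [Category.{v₁} A] {B : Type u₂} [Category.{v₂} B]
  {T : Type u₃} [Category.{v₃} T] {L : A ⥤ T} {R : B ⥤ T}

theorem preservesLimitsOfShape_fst {J : Type w} [Category.{w'} J] [HasLimitsOfShape J A]
    [HasLimitsOfShape J B] [PreservesLimitsOfShape J R] :
    PreservesLimitsOfShape J (Comma.fst L R) where
  preservesLimit :=
    preservesLimit_of_preserves_limit_cone
      (coneOfPreservesIsLimit _ (limit.isLimit _) (limit.isLimit _)) (limit.isLimit _)

theorem preservesLimitsOfShape_snd {J : Type w} [Category.{w'} J] [HasLimitsOfShape J A]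
    [HasLimitsOfShape J B] [PreservesLimitsOfShape J R] :
    PreservesLimitsOfShape J (Comma.snd L R) where
  preservesLimit :=
    preservesLimit_of_preserves_limit_cone
      (coneOfPreservesIsLimit _ (limit.isLimit _) (limit.isLimit _)) (limit.isLimit _)

variable {W X Y Z : Comma L R}

theorem isPullback_iff [HasPullbacks A] [HasPullbacks B]
    [PreservesLimitsOfShape WalkingCospan R] {t : W ⟶ X} {l : W ⟶ Y} {r : X ⟶ Z} {b : Y ⟶ Z} :
    IsPullback t l r b ↔ IsPullback t.left l.left r.left b.left ∧
      IsPullback t.right l.right r.right b.right := by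
  have := preservesLimitsOfShape_fst (J := WalkingCospan) (L := L) (R := R)
  have := preservesLimitsOfShape_snd (J := WalkingCospan) (L := L) (R := R)
  refine ⟨fun h => ⟨h.map (Comma.fst L R), h.map (Comma.snd L R)⟩, fun ⟨h₁, h₂⟩ => ?_⟩
  have w : t ≫ r = l ≫ b := by
    ext
    · exact h₁.w
    · exact h₂.w
  exact ⟨⟨w⟩, ⟨fstSndJointlyReflectLimit
    ((isLimitMapConePullbackConeEquiv (Comma.fst L R) w).symm h₁.isLimit)
    ((isLimitMapConePullbackConeEquiv (Comma.snd L R) w).symm h₂.isLimit)⟩⟩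

theorem isPushout_iff [HasPushouts A] [HasPushouts B]
    [PreservesColimitsOfShape WalkingSpan L] {t : W ⟶ X} {l : W ⟶ Y} {r : X ⟶ Z} {b : Y ⟶ Z} :
    IsPushout t l r b ↔ IsPushout t.left l.left r.left b.left ∧
      IsPushout t.right l.right r.right b.right := by
  refine ⟨fun h => ⟨h.map (Comma.fst L R), h.map (Comma.snd L R)⟩, fun ⟨h₁, h₂⟩ => ?_⟩
  have w : t ≫ r = l ≫ b := by
    ext
    · exact h₁.w
    · exact h₂.w
  exact ⟨⟨w⟩, ⟨fstSndJointlyReflectColimit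
    ((isColimitMapCoconePushoutCoconeEquiv (Comma.fst L R) w).symm h₁.isColimit)
    ((isColimitMapCoconePushoutCoconeEquiv (Comma.snd L R) w).symm h₂.isColimit)⟩⟩

/-- A comma category `L ↓ R` of adhesive categories with pullbacks and pushouts is adhesive
if `L` preserves pushouts and `R` preserves pullbacks. -/
theorem adhesive [Adhesive A] [Adhesive B] [HasPullbacks A] [HasPullbacks B] [HasPushouts A]
    [HasPushouts B] [PreservesColimitsOfShape WalkingSpan L]
    [PreservesLimitsOfShape WalkingCospan R] : Adhesive (Comma L R) where
  van_kampen {W X Y Z f g h i} _ H := by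
    have := preservesLimitsOfShape_fst (J := WalkingCospan) (L := L) (R := R)
    have := preservesLimitsOfShape_snd (J := WalkingCospan) (L := L) (R := R)
    -- The projections preserve pullbacks, hence monomorphisms.
    have : Mono f.left := inferInstanceAs (Mono ((Comma.fst L R).map f))
    have : Mono f.right := inferInstanceAs (Mono ((Comma.snd L R).map f))
    obtain ⟨H₁, H₂⟩ := isPushout_iff.1 H
    intro W' X' Y' Z' f' g' h' i' αW αX αY αZ hf hg hh hi w
    rw [isPullback_iff] at hf hg
    rw [isPushout_iff, isPullback_iff, isPullback_iff, and_and_and_comm]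
    exact and_congr
      (Adhesive.van_kampen H₁ _ _ _ _ _ _ _ _ hf.1 hg.1 (hh.map (Comma.fst L R))
        (hi.map (Comma.fst L R)) (w.map (Comma.fst L R)))
      (Adhesive.van_kampen H₂ _ _ _ _ _ _ _ _ hf.2 hg.2 (hh.map (Comma.snd L R))
        (hi.map (Comma.snd L R)) (w.map (Comma.snd L R)))

end CategoryTheory.Comma

/-! ### Tree orders as well-founded predecessor functions -/

namespace TreeOrd

theorem wellFounded_lt (E : TreeOrd.{u}) : WellFounded fun x y : E => x < y :=
  Subrelation.wf (r := InvImage (· < ·) fun e : E => (Set.Iic e).ncard)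
    (fun {_ y} h => Set.ncard_lt_ncard (Set.Iic_ssubset_Iic.2 h) (E.isTree.finite_pred y))
    (InvImage.wf _ Nat.lt_wfRel.wf)

theorem lt_of_immPred_eq_some {E : TreeOrd.{u}} {e p : E} (h : E.immPred e = some p) : p < e :=
  ((immPred_eq_some_iff E e p).1 h).1

theorem wellFounded_immPred (E : TreeOrd.{u}) :
    WellFounded fun x y : E => E.immPred y = some x :=
  Subrelation.wf (fun h => lt_of_immPred_eq_some h) E.wellFounded_lt

/-- The order is recovered by iterating `immPred`: anything strictly below `y` lies below its
immediate predecessor. -/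
theorem reflTransGen_of_le {E : TreeOrd.{u}} (x y : E) (h : x ≤ y) :
    Relation.ReflTransGen (fun a b : E => E.immPred b = some a) x y := by
  induction y using E.wellFounded_lt.induction with
  | h y ih =>
    rcases h.eq_or_lt with rfl | hlt
    · exact .refl
    · obtain ⟨p, hp⟩ := E.isTree.exists_isGreatest ⟨x, hlt⟩
      exact (ih p hp.1 (hp.2 hlt)).tail ((immPred_eq_some_iff E y p).2 hp)

/-- A map commuting with the immediate predecessor functions is automatically monotone. -/
def homMk {E F : TreeOrd.{u}} (f : E → F) (hf : ∀ e, F.immPred (f e) = (E.immPred e).map f) :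
    E ⟶ F where
  toFun := f
  monotone' x y h := by
    have h' := reflTransGen_of_le x y h
    clear h
    induction h' with
    | refl => exact le_rfl
    | tail _ hbc ih => exact ih.trans (lt_of_immPred_eq_some (by rw [hf, hbc]; rfl)).le
  strict' := hf

section ofParent

variable {E : Type u} (p : E → Option E) (wf : WellFounded fun x y : E => p y = some x)

/-- The tree order on a set in which `p` is the immediate predecessor function, for a partial
function `p` that cannot be iterated forever. -/
def ofParent : TreeOrd.{u} :=
  letI : PartialOrder E :=
    { le := Relation.ReflTransGen fun x y => p y = some x
      le_refl := fun _ => .refl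
      le_trans := fun _ _ _ => .trans
      le_antisymm := fun x y hxy hyx => by
        rcases Relation.reflTransGen_iff_eq_or_transGen.1 hxy with h | h
        · exact h.symm
        -- A nontrivial cycle would contradict well-foundedness.
        · exact (wf.transGen.irrefl.irrefl x (h.trans_left hyx)).elim }
  { carrier := E
    isTree :=
      { finite_pred := fun e => by
          induction e using wf.induction with
          | h e ih =>
            cases h : p e with
            | none =>
              refine (Set.finite_singleton e).subset fun x hx => ?_
              rcases Relation.ReflTransGen.cases_tail hx with hx | ⟨c, -, hc⟩
              · exact hx.symm
              · simp [h] at hc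
            | some q =>
              refine ((ih q h).insert e).subset fun x hx => ?_
              rcases Relation.ReflTransGen.cases_tail hx with hx | ⟨c, hxc, hc⟩
              · exact .inl hx.symm
              · obtain rfl : q = c := Option.some_inj.1 (h.symm.trans hc)
                exact .inr hxc
        chain_pred := fun e => by
          induction e using wf.induction with
          | h e ih =>
            intro x hx y hy hxy
            rcases Relation.ReflTransGen.cases_tail hx with rfl | ⟨c, hxc, hc⟩
            · exact .inr hy
            rcases Relation.ReflTransGen.cases_tail hy with rfl | ⟨d, hyd, hd⟩
            · exact .inl hx
            obtain rfl : c = d := Option.some_inj.1 (hc.symm.trans hd)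
            exact ih c hc hxc hyd hxy } }

/-- The element of `ofParent p wf` given by an element of its underlying set. -/
def toOfParent (e : E) : ofParent p wf := e

theorem immPred_ofParent (e : E) :
    (ofParent p wf).immPred (toOfParent p wf e) = (p e).map (toOfParent p wf) := by
  have key (x : ofParent p wf) (hx : x < toOfParent p wf e) :
      ∃ q, x ≤ toOfParent p wf q ∧ p e = some q := by
    rcases Relation.ReflTransGen.cases_tail hx.le with h | h
    · exact (hx.ne h.symm).elim
    · exact h
  cases h : p e with
  | none =>
    refine (immPred_eq_none_iff _ _).2 (Set.ext fun x => ⟨fun hx => ?_, fun hx => le_of_eq hx⟩)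
    by_contra hne
    obtain ⟨q, -, hq⟩ := key x (lt_of_le_of_ne hx hne)
    simp [h] at hq
  | some q =>
    have hle : toOfParent p wf q ≤ toOfParent p wf e := Relation.ReflTransGen.single h
    refine (immPred_eq_some_iff _ _ _).2 ⟨hle.lt_of_ne ?_, fun x hx => ?_⟩
    · intro (heq : q = e)
      exact wf.irrefl.irrefl e (heq ▸ h)
    · obtain ⟨r, hr, hr'⟩ := key x hx
      obtain rfl : q = r := Option.some_inj.1 (h.symm.trans hr')
      exact hr

/-- A map out of `ofParent p wf` from a map compatible with `p`. -/
def homOfParent {F : TreeOrd.{u}} (k : E → F) (hk : ∀ e, F.immPred (k e) = (p e).map k) :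
    ofParent p wf ⟶ F :=
  homMk k fun e => by
    have h : ((p e).map (toOfParent p wf)).map k = (p e).map k := Option.map_map _ _ _
    exact (hk e).trans (h.symm.trans (congrArg (Option.map k) (immPred_ofParent p wf e).symm))

end ofParent

open Limits

@[ext]
theorem hom_ext {E F : TreeOrd.{u}} {f g : E ⟶ F} (h : ∀ e, f.toFun e = g.toFun e) : f = g :=
  Hom.ext (funext h)

instance : forget.{u}.ReflectsIsomorphisms where
  reflects {E F} f hf := by
    have hb : Function.Bijective f.toFun := (isIso_iff_bijective (forget.map f)).1 hf
    let e := Equiv.ofBijective f.toFun hb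
    have he (x : F) : f.toFun (e.symm x) = x := e.apply_symm_apply x
    refine ⟨homMk e.symm fun x => ?_, ?_, ?_⟩
    · apply Option.map_injective hb.1
      rw [← f.strict', he, Option.map_map]
      convert (Option.map_id' (x := F.immPred x)).symm using 2
      exact funext he
    · ext x
      exact e.symm_apply_apply x
    · ext x
      exact he x

theorem toFun_congr {E F : TreeOrd.{u}} {f g : E ⟶ F} (h : f = g) (e : E) :
    f.toFun e = g.toFun e := by rw [h]

theorem immPred_comp {E F G : TreeOrd.{u}} (f : E → F) (g : F ⟶ G) (k : E ⟶ G)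
    (h : ∀ e, g.toFun (f e) = k.toFun e) (e : E) :
    (F.immPred (f e)).map g.toFun = ((E.immPred e).map f).map g.toFun := by
  rw [← g.strict', h, k.strict', Option.map_map]
  exact congrFun (congrArg Option.map (funext h).symm) _

/-! ### Pullbacks of tree orders -/

section Pullback

variable {P X Y Z : TreeOrd.{u}} {t : P ⟶ X} {l : P ⟶ Y} {f : X ⟶ Z} {g : Y ⟶ Z}

theorem isPullback_map_forget_iff :
    IsPullback (forget.map t) (forget.map l) (forget.map f) (forget.map g) ↔
      (∀ e, f.toFun (t.toFun e) = g.toFun (l.toFun e)) ∧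
      (∀ x y, t.toFun x = t.toFun y ∧ l.toFun x = l.toFun y → x = y) ∧
      ∀ x y, f.toFun x = g.toFun y → ∃ e, t.toFun e = x ∧ l.toFun e = y := by
  rw [Types.isPullback_iff]
  refine and_congr ⟨fun h e => ConcreteCategory.congr_hom h e, fun h => ?_⟩ Iff.rfl
  exact ConcreteCategory.hom_ext _ _ h

theorem isPullback_of_forget
    (h : IsPullback (forget.map t) (forget.map l) (forget.map f) (forget.map g)) :
    IsPullback t l f g := by
  obtain ⟨hw, hinj, hex⟩ := isPullback_map_forget_iff.1 h
  refine ⟨⟨hom_ext hw⟩, ⟨PullbackCone.isLimitAux' _ fun s => ?_⟩⟩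
  have hs (e : s.pt) : ∃ x, t.toFun x = s.fst.toFun e ∧ l.toFun x = s.snd.toFun e :=
    hex _ _ (toFun_congr s.condition e)
  choose d hd₁ hd₂ using hs
  -- The projections remain jointly injective after `Option.map`, so they detect strictness of the
  -- mediating map.
  have hopt (o o' : Option P) (h₁ : o.map t.toFun = o'.map t.toFun)
      (h₂ : o.map l.toFun = o'.map l.toFun) : o = o' := by
    cases o <;> cases o' <;> simp_all only [Option.map_some, Option.map_none, reduceCtorEq,
      Option.some_inj]
    exact hinj _ _ ⟨h₁, h₂⟩
  refine ⟨homMk d fun e => hopt _ _ (immPred_comp d t s.fst hd₁ e) (immPred_comp d l s.snd hd₂ e),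
    hom_ext hd₁, hom_ext hd₂, fun {m} h₁ h₂ => hom_ext fun e => hinj _ _ ⟨?_, ?_⟩⟩
  · exact (toFun_congr h₁ e).trans (hd₁ e).symm
  · exact (toFun_congr h₂ e).trans (hd₂ e).symm

variable (f g) in
theorem exists_isPullback : ∃ (P : TreeOrd.{u}) (t : P ⟶ X) (l : P ⟶ Y),
    IsPullback (forget.map t) (forget.map l) (forget.map f) (forget.map g) := by
  let C := { e : X × Y // f.toFun e.1 = g.toFun e.2 }
  -- The components of a compatible pair have the same image, so both are roots or neither is; in
  -- the latter case their predecessors are again compatible.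
  have hp (e : C) : ∃ o : Option C,
      o.map (fun c => c.1.1) = X.immPred e.1.1 ∧ o.map (fun c => c.1.2) = Y.immPred e.1.2 := by
    have hw : (X.immPred e.1.1).map f.toFun = (Y.immPred e.1.2).map g.toFun := by
      rw [← f.strict', ← g.strict', e.2]
    revert hw
    cases X.immPred e.1.1 <;> cases Y.immPred e.1.2 <;> intro hw
    · exact ⟨none, rfl, rfl⟩
    · simp at hw
    · simp at hw
    · exact ⟨some ⟨⟨_, _⟩, Option.some_inj.1 hw⟩, rfl, rfl⟩
  choose p hp₁ hp₂ using hp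
  have wf : WellFounded fun x y : C => p y = some x :=
    Subrelation.wf (r := InvImage (fun a b => X.immPred b = some a) fun c : C => c.1.1)
      (fun {x y} hxy => by
        change X.immPred y.1.1 = some x.1.1
        rw [← hp₁, hxy]; rfl)
      (InvImage.wf _ X.wellFounded_immPred)
  let Q := ofParent p wf
  let t : Q ⟶ X := homOfParent p wf (fun c : C => c.1.1) fun e => (hp₁ e).symm
  let l : Q ⟶ Y := homOfParent p wf (fun c : C => c.1.2) fun e => (hp₂ e).symm
  exact ⟨Q, t, l, isPullback_map_forget_iff.2 ⟨fun e : C => e.2,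
    fun x y h => Subtype.ext (Prod.ext h.1 h.2), fun x y h => ⟨(⟨(x, y), h⟩ : C), rfl, rfl⟩⟩⟩

instance : HasPullbacks TreeOrd.{u} :=
  have (X Y Z : TreeOrd.{u}) (f : X ⟶ Z) (g : Y ⟶ Z) : HasPullback f g :=
    let ⟨_, _, _, h⟩ := exists_isPullback f g
    (isPullback_of_forget h).hasPullback
  hasPullbacks_of_hasLimit_cospan _

instance : PreservesLimitsOfShape WalkingCospan forget.{u} where
  preservesLimit {K} := by
    obtain ⟨_, _, _, h⟩ := exists_isPullback (K.map WalkingCospan.Hom.inl)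
      (K.map WalkingCospan.Hom.inr)
    have h' := isPullback_of_forget h
    have := preservesLimit_of_preserves_limit_cone h'.isLimit
      ((isLimitMapConePullbackConeEquiv forget h'.w).symm h.isLimit)
    exact preservesLimit_of_iso_diagram _ (diagramIsoCospan K).symm

end Pullback

/-! ### Pushouts of tree orders -/

section Pushout

variable {X Y Z : TreeOrd.{u}} {f : Z ⟶ X} {g : Z ⟶ Y}

theorem isPushout_of_forget {P : TreeOrd.{u}} {r : X ⟶ P} {b : Y ⟶ P}
    (h : IsPushout (forget.map f) (forget.map g) (forget.map r) (forget.map b)) :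
    IsPushout f g r b := by
  refine ⟨⟨hom_ext fun e => ConcreteCategory.congr_hom h.w e⟩,
    ⟨PushoutCocone.isColimitAux' _ fun s => ?_⟩⟩
  have hs : forget.map f ≫ forget.map s.inl = forget.map g ≫ forget.map s.inr := by
    rw [← Functor.map_comp, ← Functor.map_comp, s.condition]
  let d : P → s.pt := h.desc _ _ hs
  have hd₁ (x : X) : d (r.toFun x) = s.inl.toFun x :=
    ConcreteCategory.congr_hom (h.inl_desc _ _ hs) x
  have hd₂ (y : Y) : d (b.toFun y) = s.inr.toFun y :=
    ConcreteCategory.congr_hom (h.inr_desc _ _ hs) y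
  -- Joint surjectivity of the legs reduces strictness of `d` to that of the cocone maps.
  have hsurj (e : P) : (∃ x, r.toFun x = e) ∨ ∃ y, b.toFun y = e :=
    Types.eq_or_eq_of_isPushout h e
  have hd (e : P) : s.pt.immPred (d e) = (P.immPred e).map d := by
    rcases hsurj e with ⟨x, rfl⟩ | ⟨y, rfl⟩
    · rw [hd₁, r.strict', s.inl.strict', Option.map_map]
      exact congrFun (congrArg Option.map (funext hd₁).symm) _
    · rw [hd₂, b.strict', s.inr.strict', Option.map_map]
      exact congrFun (congrArg Option.map (funext hd₂).symm) _
  refine ⟨homMk d hd, hom_ext hd₁, hom_ext hd₂, fun {m} h₁ h₂ => hom_ext fun e => ?_⟩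
  · rcases hsurj e with ⟨x, rfl⟩ | ⟨y, rfl⟩
    · exact (toFun_congr h₁ x).trans (hd₁ x).symm
    · exact (toFun_congr h₂ y).trans (hd₂ y).symm

variable (f g) in
theorem exists_isPushout : ∃ (P : TreeOrd.{u}) (r : X ⟶ P) (b : Y ⟶ P),
    IsPushout (forget.map f) (forget.map g) (forget.map r) (forget.map b) := by
  obtain ⟨P, r', b', h⟩ : ∃ (P : Type u) (r' : X → P) (b' : Y → P),
      IsPushout (forget.map f) (forget.map g) (↾r') (↾b') :=
    ⟨_, _, _, IsPushout.of_hasPushout _ _⟩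
  have hw : r' ∘ f.toFun = b' ∘ g.toFun := funext fun e => ConcreteCategory.congr_hom h.w e
  -- By strictness of `f` and `g`, the predecessor functions form a cocone, which induces `p` on the
  -- set-level pushout.
  have hp : forget.map f ≫ (↾fun x : X => (X.immPred x).map r') =
      forget.map g ≫ (↾fun y : Y => (Y.immPred y).map b') := by
    have he (e : Z) : (X.immPred (f.toFun e)).map r' = (Y.immPred (g.toFun e)).map b' := by
      rw [f.strict', g.strict', Option.map_map, Option.map_map, hw]
    exact ConcreteCategory.hom_ext _ _ he
  obtain ⟨p, hr, hb⟩ : ∃ p : P → Option P, (∀ x, p (r' x) = (X.immPred x).map r') ∧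
      ∀ y, p (b' y) = (Y.immPred y).map b' :=
    ⟨h.desc _ _ hp, fun x => ConcreteCategory.congr_hom (h.inl_desc _ _ hp) x,
      fun y => ConcreteCategory.congr_hom (h.inr_desc _ _ hp) y⟩
  -- Each `p`-predecessor of `k e` is the image of a predecessor of `e`, so accessibility passes
  -- along the legs.
  have acc_of {E : TreeOrd.{u}} {k : E → P} (hk : ∀ e, p (k e) = (E.immPred e).map k) (e : E) :
      Acc (fun x y : P => p y = some x) (k e) := by
    induction e using E.wellFounded_immPred.induction with
    | h e ih =>
      refine ⟨_, fun q hq => ?_⟩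
      rw [hk, Option.map_eq_some_iff] at hq
      obtain ⟨a, ha, rfl⟩ := hq
      exact ih a ha
  have wf : WellFounded fun x y : P => p y = some x := by
    refine ⟨fun e => ?_⟩
    rcases Types.eq_or_eq_of_isPushout h e with ⟨x, rfl⟩ | ⟨y, rfl⟩
    · exact acc_of hr x
    · exact acc_of hb y
  let Q := ofParent p wf
  have strict_of {E : TreeOrd.{u}} {k : E → P} (hk : ∀ e, p (k e) = (E.immPred e).map k) (e : E) :
      Q.immPred (toOfParent p wf (k e)) = (E.immPred e).map fun x => toOfParent p wf (k x) := by
    rw [immPred_ofParent, hk, Option.map_map]; rfl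
  exact ⟨Q, homMk _ (strict_of hr), homMk _ (strict_of hb), h⟩

instance : HasPushouts TreeOrd.{u} :=
  have (X Y Z : TreeOrd.{u}) (f : Z ⟶ X) (g : Z ⟶ Y) : HasPushout f g :=
    let ⟨_, _, _, h⟩ := exists_isPushout f g
    (isPushout_of_forget h).hasPushout
  hasPushouts_of_hasColimit_span _

instance : PreservesColimitsOfShape WalkingSpan forget.{u} where
  preservesColimit {K} := by
    obtain ⟨_, _, _, h⟩ := exists_isPushout (K.map WalkingSpan.Hom.fst)
      (K.map WalkingSpan.Hom.snd)
    have h' := isPushout_of_forget h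
    have := preservesColimit_of_preserves_colimit_cocone h'.isColimit
      ((isColimitMapCoconePushoutCoconeEquiv forget h'.w).symm h.isColimit)
    exact preservesColimit_of_iso_diagram _ (diagramIsoSpan K).symm

end Pushout

instance : Adhesive TreeOrd.{u} := adhesive_of_preserves_and_reflects_isomorphism forget

end TreeOrd

/-! ### The Kleene star and the conclusion -/

open Limits in
-- Two words with the same image have equal length, so they pair up letter by letter into a unique
-- word over the pullback.
theorem isPullback_map_kleeneStar {P X Y Z : Type u} {t : P ⟶ X} {l : P ⟶ Y} {f : X ⟶ Z}
    {g : Y ⟶ Z} (h : IsPullback t l f g) : IsPullback (kleeneStar.map t) (kleeneStar.map l)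
      (kleeneStar.map f) (kleeneStar.map g) := by
  refine (Types.isPullback_iff _ _ _ _).2
    ⟨by rw [← Functor.map_comp, h.w, Functor.map_comp], ?_, ?_⟩
  · rintro x y ⟨h₁, h₂⟩
    change List.map t x = List.map t y at h₁
    change List.map l x = List.map l y at h₂
    induction x generalizing y with
    | nil => exact (List.map_eq_nil_iff.1 h₁.symm).symm
    | cons a x ih =>
      cases y with
      | nil => simp at h₁
      | cons c y =>
        rw [List.map_cons, List.map_cons, List.cons.injEq] at h₁ h₂
        rw [Types.ext_of_isPullback h h₁.1 h₂.1, ih y h₁.2 h₂.2]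
  · intro x y hxy
    change List.map f x = List.map g y at hxy
    induction x generalizing y with
    | nil =>
      obtain rfl : y = [] := List.map_eq_nil_iff.1 hxy.symm
      exact ⟨([] : List P), rfl, rfl⟩
    | cons a x ih =>
      cases y with
      | nil => simp at hxy
      | cons c y =>
        rw [List.map_cons, List.map_cons, List.cons.injEq] at hxy
        obtain ⟨q, rfl, rfl⟩ := Types.exists_of_isPullback h a c hxy.1
        obtain ⟨w, rfl, rfl⟩ := ih y hxy.2
        exact ⟨(q :: w : List P), rfl, rfl⟩

open Limits in
instance : PreservesLimitsOfShape WalkingCospan kleeneStar.{u} where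
  preservesLimit {K} := by
    have h := IsPullback.of_hasPullback (K.map WalkingCospan.Hom.inl) (K.map WalkingCospan.Hom.inr)
    have := preservesLimit_of_preserves_limit_cone h.isLimit
      ((isLimitMapConePullbackConeEquiv kleeneStar h.w).symm (isPullback_map_kleeneStar h).isLimit)
    exact preservesLimit_of_iso_diagram _ (diagramIsoCospan K).symm

theorem mainTheorem9 : CategoryTheory.Adhesive HHIGraph.{u} := by
  have : Adhesive HHGraph.{u} := Comma.adhesive
  -- A left adjoint preserves all colimits, in particular pushouts.
  have := HHGraph.discreteAdjunction.{u}.leftAdjoint_preservesColimits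
  exact Comma.adhesive
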